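/- Let $R$ be a commutative Noetherian local ring with maximal ideal $\mathfrak m$, and let $M$ and $N$ be non-zero finitely generated $R$-modules. A non-zero finitely generated $R$-module $L$ is called Cohen–Macaulay if $\operatorname{depth} L=\dim L$, where $\operatorname{depth} L$ is the supremum of the lengths of the $L$-regular sequences in $\mathfrak m$ and $\dim L$ is the Krull dimension of the support of $L$. Put $\operatorname{grade}(M,N)=\inf\{i\ge 0 : \operatorname{Ext}^i_R(M,N)\neq 0\}$. If $M$ has finite projective dimension $\operatorname{pd}_R M$, then $M$ is called $N$-perfect if $\operatorname{pd}_R M=\operatorname{grade}(M,N)$. Suppose that $N$ is Cohen–Macaulay, that $M$ has finite projective dimension, and that $\operatorname{Tor}_i^R(M,N)=0$ for all $i>0$. Then $M\otimes_R N$ is Cohen–Macaulay if and only if $M$ is $N$-perfect. -/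

import Mathlib

open scoped TensorProduct
open CategoryTheory

universe u

/-- The depth of a module `M` over a local ring: the supremum of the lengths of the `M`-regular
sequences in the maximal ideal. For a nonzero finitely generated `M` over a Noetherian local ring
the condition `M / (rs) M ≠ 0` is automatic for `rs` in the maximal ideal (Nakayama). Leaving it out
only affects the zero module, whose depth is then infinite, as is the usual convention. -/
noncomputable def moduleDepth (R : Type u) [CommRing R] [IsLocalRing R]
    (M : Type u) [AddCommGroup M] [Module R M] : ℕ∞ :=
  ⨆ (rs : List R) (_ : (∀ r ∈ rs, r ∈ IsLocalRing.maximalIdeal R) ∧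
    RingTheory.Sequence.IsWeaklyRegular M rs), (rs.length : ℕ∞)

/-- A (nonzero, finitely generated) module `M` over a Noetherian local ring is Cohen-Macaulay
if its depth equals its Krull dimension, the dimension of its support. -/
def IsCohenMacaulayModule (R : Type u) [CommRing R] [IsLocalRing R]
    (M : Type u) [AddCommGroup M] [Module R M] : Prop :=
  ((moduleDepth R M : ℕ∞) : WithBot ℕ∞) = Module.supportDim R M

/-- `grade (M, N) = inf {i | Ext^i_R (M, N) ≠ 0}`, which is `⊤` if all these groups vanish. -/
noncomputable def moduleGrade (R : Type u) [CommRing R] (M N : Type u)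
    [AddCommGroup M] [Module R M] [AddCommGroup N] [Module R N] : ℕ∞ :=
  ⨅ (i : ℕ) (_ : Nontrivial (Abelian.Ext (ModuleCat.of R M) (ModuleCat.of R N) i)), (i : ℕ∞)

/-- The projective dimension of a module; it is `⊥` for the zero module. -/
noncomputable def projDim (R : Type u) [CommRing R] (M : Type u)
    [AddCommGroup M] [Module R M] : WithBot ℕ∞ :=
  projectiveDimension (ModuleCat.of R M)

/-- `M` is `N`-perfect: it has finite projective dimension, equal to `grade (M, N)`. -/
def IsPerfectRel (R : Type u) [CommRing R] (M N : Type u)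
    [AddCommGroup M] [Module R M] [AddCommGroup N] [Module R N] : Prop :=
  projDim R M < ⊤ ∧ projDim R M = ((moduleGrade R M N : ℕ∞) : WithBot ℕ∞)

/-- `Tor_i^R (M, N) = 0`. -/
def TorVanishes (R : Type u) [CommRing R] (M N : Type u)
    [AddCommGroup M] [Module R M] [AddCommGroup N] [Module R N] (i : ℕ) : Prop :=
  Limits.IsZero (((Tor (ModuleCat.{u} R) i).obj (ModuleCat.of R M)).obj (ModuleCat.of R N))

/-!
Write `k = R / m`, and assume that `N` is Cohen–Macaulay of dimension `d`. Two formulas together give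
the theorem:

* the depth formula `depth (M ⊗ N) + pd M = depth N = d`
  (`exists_isFirstExt_tensorProduct_add_projectiveDimension`);
* the grade formula `grade (M, N) + dim (M ⊗ N) = dim N = d`
  (`exists_isFirstExt_add_supportDim_tensorProduct`).

All terms are natural numbers, so `depth (M ⊗ N) = dim (M ⊗ N)` if and only if
`pd M = grade (M, N)`.

By Rees' theorem the depth of `N` is the first `i` with `Ext^i (k, N) ≠ 0` (`moduleDepth_eq_iff`).
So depth and grade are both handled through `IsFirstExt`, the first nonvanishing degree of `Ext`.

The depth formula is an induction on `pd M` along `0 → K → F → M → 0` with `F` finite free, which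
stays exact after tensoring with `N`. If `pd M ≥ 2`, then `depth (K ⊗ N) < depth (F ⊗ N)` and the
depth lemma applies. If `pd M = 1`, then `K` is free and the inclusion `K → F` does not split, so
some basis element of `K` goes into `mF`. Since `m` kills `Ext (k, -)`, the map
`Ext^d (k, K ⊗ N) → Ext^d (k, F ⊗ N)` is not injective (`exists_ext_comp_rTensor_eq_zero`), and the
depth drops in this case as well. Minimal resolutions are not needed. Mathlib's `Tor` is derived in
its second argument, whereas the induction changes the first one. A single diagram chase with a
fixed projective resolution of `N` passes the vanishing of `Tor` from `M` to `K`
(`mem_range_lTensor_of_rTensor_mem_range`).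

The grade formula is an induction on `d`. If `Hom (M, N) = 0`, then some `x` annihilating `M` is
`N`-regular, and `N` may be replaced by `N / xN`. Otherwise the support of `M` contains an
associated prime `p` of `N`, and `dim R / p ≥ depth N = d`
(`le_supportDim_quotient_associatedPrime`), so that `M ⊗ N` has dimension `d`.
-/

open Abelian Pointwise IsLocalRing

/-! ### The first nonvanishing `Ext` -/

/-- `n` is the first degree in which `Ext_R (M, N)` does not vanish. Unlike an equality
`moduleGrade R M N = n`, this separates the vanishing below `n` from the nonvanishing in degree
`n`, which is the form in which long exact sequences produce it. -/
def IsFirstExt (R : Type u) [CommRing R] (M N : Type u) [AddCommGroup M] [Module R M]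
    [AddCommGroup N] [Module R N] (n : ℕ) : Prop :=
  (∀ i < n, Subsingleton (Ext.{u} (ModuleCat.of R M) (ModuleCat.of R N) i)) ∧
    Nontrivial (Ext.{u} (ModuleCat.of R M) (ModuleCat.of R N) n)

section FirstExt

variable {R : Type u} [CommRing R] {M N : Type u} [AddCommGroup M] [Module R M]
  [AddCommGroup N] [Module R N]

lemma IsFirstExt.moduleGrade_eq {n : ℕ} (h : IsFirstExt R M N n) : moduleGrade R M N = n := by
  refine le_antisymm (iInf₂_le n h.2) (le_iInf₂ fun i hi ↦ ?_)
  by_contra! hlt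
  exact not_subsingleton_iff_nontrivial.mpr hi (h.1 i (by exact_mod_cast hlt))

lemma subsingleton_ext_zero_iff :
    Subsingleton (Ext.{u} (ModuleCat.of R M) (ModuleCat.of R N) 0) ↔ Subsingleton (M →ₗ[R] N) :=
  (Ext.addEquiv₀.trans ModuleCat.homAddEquiv).subsingleton_congr

lemma ext_smul_eq_zero_of_mem_annihilator {x : R} (hx : x ∈ Module.annihilator R M)
    {Y : ModuleCat.{u} R} {n : ℕ} (e : Ext.{u} (ModuleCat.of R M) Y n) : x • e = 0 := by
  have h := congrArg (fun f ↦ f.hom e)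
    (Ext.postcomp_smul_id_eq_zero_of_mem_annihilator (N := ModuleCat.of R M) (M := Y) hx n)
  simpa [Ext.mk₀_smul] using h

variable {x : R} (hx : x ∈ Module.annihilator R M) (reg : IsSMulRegular N x)
include reg

lemma subsingleton_ext_quotSMulTop {i : ℕ}
    (h₀ : Subsingleton (Ext.{u} (ModuleCat.of R M) (ModuleCat.of R N) i))
    (h₁ : Subsingleton (Ext.{u} (ModuleCat.of R M) (ModuleCat.of R N) (i + 1))) :
    Subsingleton (Ext.{u} (ModuleCat.of R M) (ModuleCat.of R (QuotSMulTop x N)) i) := by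
  refine subsingleton_of_forall_eq 0 fun e ↦ ?_
  obtain ⟨y, hy⟩ := Ext.covariant_sequence_exact₃ (ModuleCat.of R M)
    (IsSMulRegular.smulShortComplex_shortExact (M := ModuleCat.of R N) reg) e rfl
    (h₁.elim _ _)
  obtain rfl : y = 0 := h₀.elim _ _
  exact hy.symm.trans (Ext.zero_comp ..)

include hx

/-- Multiplication by `x` vanishes on `Ext (M, N)`, so the connecting map from `Ext^i (M, N / xN)`
to `Ext^(i+1) (M, N)` is surjective. -/
lemma nontrivial_ext_quotSMulTop {i : ℕ}
    (h : Nontrivial (Ext.{u} (ModuleCat.of R M) (ModuleCat.of R N) (i + 1))) :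
    Nontrivial (Ext.{u} (ModuleCat.of R M) (ModuleCat.of R (QuotSMulTop x N)) i) := by
  obtain ⟨e, he⟩ := exists_ne (0 : Ext.{u} (ModuleCat.of R M) (ModuleCat.of R N) (i + 1))
  have hS := IsSMulRegular.smulShortComplex_shortExact (M := ModuleCat.of R N) reg
  have hf : e.comp (Ext.mk₀ (ModuleCat.smulShortComplex (ModuleCat.of R N) x).f)
      (add_zero _) = 0 := by
    have hsmul : e.comp (Ext.mk₀ (x • 𝟙 (ModuleCat.of R N))) (add_zero _) = 0 := by
      rw [Ext.mk₀_smul, Ext.comp_smul]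
      exact ext_smul_eq_zero_of_mem_annihilator hx _
    exact hsmul
  obtain ⟨y, hy⟩ := Ext.covariant_sequence_exact₁ (ModuleCat.of R M) hS e hf rfl
  refine ⟨y, 0, ?_⟩
  rintro rfl
  exact he (hy.symm.trans (Ext.zero_comp ..))

lemma isFirstExt_quotSMulTop_iff {n : ℕ} :
    IsFirstExt R M (QuotSMulTop x N) n ↔ IsFirstExt R M N (n + 1) := by
  constructor
  · rintro ⟨h₁, h₂⟩
    have hlt (i : ℕ) (hi : i < n + 1) :
        Subsingleton (Ext.{u} (ModuleCat.of R M) (ModuleCat.of R N) i) := by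
      obtain _ | i := i
      · exact subsingleton_ext_zero_iff.mpr (reg.linearMap_subsingleton_of_mem_annihilator hx)
      · by_contra! h
        exact not_subsingleton_iff_nontrivial.mpr (nontrivial_ext_quotSMulTop hx reg h)
          (h₁ i (by omega))
    refine ⟨hlt, ?_⟩
    by_contra! h
    exact not_subsingleton_iff_nontrivial.mpr h₂
      (subsingleton_ext_quotSMulTop reg (hlt n (by omega)) h)
  · rintro ⟨h₁, h₂⟩
    exact ⟨fun i hi ↦ subsingleton_ext_quotSMulTop reg (h₁ i (by omega)) (h₁ _ (by omega)),
      nontrivial_ext_quotSMulTop hx reg h₂⟩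

end FirstExt

/-! ### Depth -/

section Depth

variable {R : Type u} [CommRing R] [IsLocalRing R] [IsNoetherianRing R]
  {N : Type u} [AddCommGroup N] [Module R N] [Module.Finite R N]

/-- Rees' theorem for the maximal ideal. -/
lemma le_moduleDepth_iff [Nontrivial N] (n : ℕ) :
    (n : ℕ∞) ≤ moduleDepth R N ↔ ∀ i < n,
      Subsingleton (Ext.{u} (ModuleCat.of R (R ⧸ maximalIdeal R)) (ModuleCat.of R N) i) := by
  have hlt : maximalIdeal R • (⊤ : Submodule R N) < ⊤ :=
    (Submodule.top_ne_ideal_smul_of_le_jacobson_annihilator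
      (maximalIdeal_le_jacobson _)).symm.lt_top
  have hsupp : Module.support R (R ⧸ maximalIdeal R) =
      PrimeSpectrum.zeroLocus (maximalIdeal R) := by
    rw [Module.support_eq_zeroLocus, Ideal.annihilator_quotient]
  constructor
  · intro h i hi
    have hi' : (i : ℕ∞) < moduleDepth R N := lt_of_lt_of_le (by exact_mod_cast hi) h
    simp only [moduleDepth, lt_iSup_iff] at hi'
    obtain ⟨rs, ⟨hmem, hreg⟩, hlen⟩ := hi'
    exact ModuleCat.subsingleton_ext_of_exists_isRegular (maximalIdeal R)
      (ModuleCat.of R (R ⧸ maximalIdeal R)) hsupp.subset (ModuleCat.of R N) hlt rs hmem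
      (.of_isWeaklyRegular_of_mem_maximalIdeal N hmem hreg) i (by exact_mod_cast hlen)
  · intro h
    obtain ⟨rs, hlen, hmem, hreg⟩ := ModuleCat.exists_isRegular_of_exists_subsingleton_ext
      (maximalIdeal R) n (ModuleCat.of R N) hlt (ModuleCat.of R (R ⧸ maximalIdeal R)) hsupp h
    rw [← hlen]
    exact le_iSup₂_of_le rs ⟨hmem, hreg.1⟩ le_rfl

lemma moduleDepth_eq_iff [Nontrivial N] (n : ℕ) :
    moduleDepth R N = n ↔ IsFirstExt R (R ⧸ maximalIdeal R) N n := by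
  have key : moduleDepth R N = n ↔
      (n : ℕ∞) ≤ moduleDepth R N ∧ ¬ ((n + 1 : ℕ) : ℕ∞) ≤ moduleDepth R N := by
    constructor
    · intro h
      rw [h]
      exact ⟨le_rfl, by simp [-Nat.cast_add]⟩
    · rintro ⟨h₁, h₂⟩
      refine le_antisymm ?_ h₁
      rw [not_le] at h₂
      exact Order.le_of_lt_add_one (by exact_mod_cast h₂)
  rw [key, le_moduleDepth_iff, le_moduleDepth_iff, IsFirstExt]
  refine and_congr_right fun h ↦ ?_
  rw [← not_subsingleton_iff_nontrivial, not_iff_not]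
  exact ⟨fun h' ↦ h' n (by omega), fun h' i hi ↦ by
    obtain rfl | hi := (Nat.lt_succ_iff.mp hi).eq_or_lt
    exacts [h', h i hi]⟩

/-- If `p` is the annihilator of an element of `N`, then for an `N`-regular element `x` of the
maximal ideal there is an associated prime of `N / xN` above `p` containing `x`. -/
lemma exists_associatedPrime_quotSMulTop {x : R} (hx : x ∈ maximalIdeal R)
    (reg : IsSMulRegular N x) {p : Ideal R} (hp : p ∈ associatedPrimes R N) :
    ∃ q ∈ associatedPrimes R (QuotSMulTop x N), p ≤ q ∧ x ∈ q := by
  -- The elements killed by `p` form a nonzero submodule `L` with `L ∩ xN = xL`, so by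
  -- Nakayama's lemma `L` is not contained in `xN`.
  let L : Submodule R N := Submodule.torsionBySet R N p
  have hL (n : N) : n ∈ L ↔ ∀ a ∈ p, a • n = 0 := by
    simp [L, Submodule.mem_torsionBySet_iff]
  obtain ⟨hprime, y, hy⟩ := isAssociatedPrime_iff.mp hp
  have hyL : y ∈ L := (hL y).mpr fun a ha ↦ by
    rw [hy] at ha
    simpa [Submodule.mem_colon_singleton] using ha
  have hy0 : y ≠ 0 := by
    rintro rfl
    apply hprime.ne_top
    rw [hy]
    simp
  obtain ⟨z, hzL, hz⟩ : ∃ z ∈ L, z ∉ x • (⊤ : Submodule R N) := by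
    by_contra! h
    have hle : L ≤ x • L := fun n hn ↦ by
      obtain ⟨n', -, rfl⟩ := (Submodule.mem_smul_pointwise_iff_exists _ _ _).mp (h n hn)
      refine Submodule.smul_mem_pointwise_smul _ _ _ ((hL n').mpr fun a ha ↦ reg ?_)
      change x • a • n' = x • (0 : N)
      rw [smul_comm, (hL _).mp hn a ha, smul_zero]
    have hbot : L = ⊥ := by
      refine Submodule.eq_bot_of_le_smul_of_le_jacobson_bot (maximalIdeal R) L
        (IsNoetherian.noetherian L) (hle.trans ?_) (maximalIdeal_le_jacobson _)
      rintro _ ⟨n, hn, rfl⟩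
      exact Submodule.smul_mem_smul hx hn
    rw [hbot] at hyL
    exact hy0 (by simpa using hyL)
  obtain ⟨q, hq, hle⟩ := exists_le_isAssociatedPrime_of_isNoetherianRing R
    (Submodule.Quotient.mk z : QuotSMulTop x N)
    (by rwa [Ne, Submodule.Quotient.mk_eq_zero])
  refine ⟨q, hq, fun a ha ↦ hle ?_, hle ?_⟩
  · rw [Submodule.mem_colon_singleton, ← Submodule.Quotient.mk_smul, (hL z).mp hzL a ha]
    simp
  · rw [Submodule.mem_colon_singleton, ← Submodule.Quotient.mk_smul, Submodule.mem_bot,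
      Submodule.Quotient.mk_eq_zero]
    exact Submodule.smul_mem_pointwise_smul _ _ _ trivial

/-- The depth of `N` is at most `dim R / p` for every associated prime `p` of `N`. -/
lemma le_supportDim_quotient_associatedPrime {d : ℕ}
    (h : ∀ i < d,
      Subsingleton (Ext.{u} (ModuleCat.of R (R ⧸ maximalIdeal R)) (ModuleCat.of R N) i))
    {p : Ideal R} (hp : p ∈ associatedPrimes R N) :
    (d : WithBot ℕ∞) ≤ Module.supportDim R (R ⧸ p) := by
  induction d generalizing N p with
  | zero =>
    have := hp.isPrime.ne_top
    have : Nontrivial (R ⧸ p) := Ideal.Quotient.nontrivial_iff.mpr this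
    have h := Module.supportDim_ne_bot_of_nontrivial R (R ⧸ p)
    obtain ⟨a, ha⟩ := WithBot.ne_bot_iff_exists.mp h
    rw [← ha]
    exact_mod_cast zero_le (a := a)
  | succ d ih =>
    have hHom := subsingleton_ext_zero_iff.mp (h 0 (by omega))
    obtain ⟨x, hx, reg⟩ := IsSMulRegular.subsingleton_linearMap_iff.mp hHom
    have hxm : x ∈ maximalIdeal R := by rwa [Ideal.annihilator_quotient] at hx
    obtain ⟨q, hq, hpq, hxq⟩ := exists_associatedPrime_quotSMulTop hxm reg hp
    have hdim := ih (N := QuotSMulTop x N)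
      (fun i hi ↦ subsingleton_ext_quotSMulTop reg (h i (by omega)) (h _ (by omega))) hq
    have hprime := hp.isPrime
    have hxp : x ∉ p := by
      intro hxp
      obtain ⟨hprime, y, hy⟩ := isAssociatedPrime_iff.mp hp
      rw [hy, Submodule.mem_colon_singleton, Submodule.mem_bot] at hxp
      have : y = 0 := reg (by simpa using hxp)
      apply hprime.ne_top
      rw [hy, this]
      simp
    have hreg : IsSMulRegular (R ⧸ p) x := by
      rw [isSMulRegular_iff_right_eq_zero_of_smul]
      intro a ha
      rw [Algebra.smul_def, mul_eq_zero] at ha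
      exact ha.resolve_left (by simpa [Ideal.Quotient.eq_zero_iff_mem] using hxp)
    rw [← Module.supportDim_quotSMulTop_succ_eq_supportDim hreg hxm]
    push_cast
    gcongr
    refine hdim.trans (Order.krullDim_le_of_strictMono (fun a ↦ ⟨a.1, ?_⟩) fun _ _ hlt ↦ hlt)
    obtain ⟨a, ha⟩ := a
    rw [Module.support_eq_zeroLocus, Ideal.annihilator_quotient] at ha
    rw [Module.support_quotSMulTop, Module.support_eq_zeroLocus, Ideal.annihilator_quotient]
    exact ⟨fun b hb ↦ ha (hpq hb), fun b hb ↦ ha (by rwa [Set.mem_singleton_iff.mp hb])⟩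

end Depth

/-! ### Grade and dimension over a Cohen–Macaulay module -/

section Support

variable {R : Type u} [CommRing R] {M N : Type u} [AddCommGroup M] [Module R M]
  [AddCommGroup N] [Module R N] [Module.Finite R M] [Module.Finite R N]

lemma support_tensorProduct :
    Module.support R (M ⊗[R] N) = Module.support R M ∩ Module.support R N := by
  ext p
  rw [Set.mem_inter_iff]
  simp only [Module.mem_support_iff_nontrivial_residueField_tensorProduct]
  let K := p.asIdeal.ResidueField
  rw [(TensorProduct.AlgebraTensorModule.distribBaseChange R K M N).nontrivial_congr]
  constructor
  · intro h
    constructor <;> by_contra! h'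
    · exact not_subsingleton_iff_nontrivial.mpr h inferInstance
    · exact not_subsingleton_iff_nontrivial.mpr h inferInstance
  · rintro ⟨h₁, h₂⟩
    exact (Module.FaithfullyFlat.nontrivial_tensorProduct_iff_right K (K ⊗[R] M)).mpr h₂

variable [IsLocalRing R]

lemma nontrivial_tensorProduct [Nontrivial M] [Nontrivial N] : Nontrivial (M ⊗[R] N) := by
  have hclosed (L : Type u) [AddCommGroup L] [Module R L] [Module.Finite R L] [Nontrivial L] :
      closedPoint R ∈ Module.support R L :=
    Module.mem_support_iff_of_finite.mpr
      (le_maximalIdeal (by rw [Ne, Module.annihilator_eq_top_iff]; exact not_subsingleton L))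
  rw [← Module.nonempty_support_iff (R := R), support_tensorProduct]
  exact ⟨closedPoint R, hclosed M, hclosed N⟩

end Support

section Grade

lemma supportDim_eq_natCast (R : Type u) [CommRing R] [IsLocalRing R] [IsNoetherianRing R]
    (M : Type u) [AddCommGroup M] [Module R M] [Nontrivial M] :
    ∃ d : ℕ, Module.supportDim R M = d := by
  have h₁ := Module.supportDim_ne_bot_of_nontrivial R M
  have h₂ := (Module.supportDim_le_ringKrullDim R M).trans_lt ringKrullDim_lt_top
  obtain ⟨a, ha⟩ := WithBot.ne_bot_iff_exists.mp h₁
  rw [← ha] at h₂ ⊢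
  obtain ⟨n, hn⟩ := ENat.ne_top_iff_exists.mp (WithBot.coe_lt_coe.mp h₂).ne
  exact ⟨n, by rw [← hn]; rfl⟩

lemma exists_associatedPrime_of_nontrivial_linearMap {R : Type u} [CommRing R]
    [IsNoetherianRing R] {M N : Type u} [AddCommGroup M] [Module R M] [AddCommGroup N]
    [Module R N] [Module.Finite R N] (h : Nontrivial (M →ₗ[R] N)) :
    ∃ p ∈ associatedPrimes R N, Module.annihilator R M ≤ p := by
  have hN : Nontrivial N := by
    by_contra! hN
    exact not_subsingleton_iff_nontrivial.mpr h inferInstance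
  obtain ⟨I, -⟩ := associatedPrimes.nonempty R N
  refine (Ideal.subset_union_prime_finite (associatedPrimes.finite R N) I I
    fun J hJ _ _ ↦ IsAssociatedPrime.isPrime hJ).mp ?_
  rw [biUnion_associatedPrimes_eq_compl_regular R N]
  exact fun r hr hreg ↦ not_subsingleton_iff_nontrivial.mpr h
    (hreg.linearMap_subsingleton_of_mem_annihilator hr)

variable {R : Type u} [CommRing R] [IsLocalRing R] [IsNoetherianRing R]
  {M N : Type u} [AddCommGroup M] [Module R M] [AddCommGroup N] [Module R N]
  [Module.Finite R M] [Module.Finite R N]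

/-- If `N` is Cohen–Macaulay and `Hom (M, N) ≠ 0`, then the support of `M` contains an associated
prime of `N`, and hence `M ⊗ N` has the dimension of `N`. -/
lemma supportDim_tensorProduct_of_nontrivial_linearMap {d : ℕ}
    (hdepth : IsFirstExt R (R ⧸ maximalIdeal R) N d) (hdim : Module.supportDim R N = d)
    (h : Nontrivial (M →ₗ[R] N)) : Module.supportDim R (M ⊗[R] N) = d := by
  refine le_antisymm ?_ ?_
  · rw [← hdim]
    refine Order.krullDim_le_of_strictMono (fun a ↦ ⟨a.1, ?_⟩) fun _ _ hlt ↦ hlt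
    obtain ⟨a, ha⟩ := a
    rw [support_tensorProduct] at ha
    exact ha.2
  · obtain ⟨p, hp, hMp⟩ := exists_associatedPrime_of_nontrivial_linearMap h
    have hNp : Module.annihilator R N ≤ p := by
      obtain ⟨-, y, rfl⟩ := isAssociatedPrime_iff.mp hp
      intro a ha
      simp [Submodule.mem_colon_singleton, Module.mem_annihilator.mp ha y]
    refine (le_supportDim_quotient_associatedPrime hdepth.1 hp).trans
      (Order.krullDim_le_of_strictMono (fun a ↦ ⟨a.1, ?_⟩) fun _ _ hlt ↦ hlt)
    obtain ⟨a, ha⟩ := a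
    rw [Module.support_eq_zeroLocus, Ideal.annihilator_quotient] at ha
    rw [support_tensorProduct, Module.support_eq_zeroLocus, Module.support_eq_zeroLocus]
    exact ⟨fun b hb ↦ ha (hMp hb), fun b hb ↦ ha (hNp hb)⟩

/-- For `N` Cohen–Macaulay of dimension `d`, `grade (M, N) + dim (M ⊗ N) = d`. -/
lemma exists_isFirstExt_add_supportDim_tensorProduct [Nontrivial M] [Nontrivial N] {d : ℕ}
    (hdepth : IsFirstExt R (R ⧸ maximalIdeal R) N d) (hdim : Module.supportDim R N = d) :
    ∃ g e : ℕ, g + e = d ∧ IsFirstExt R M N g ∧ Module.supportDim R (M ⊗[R] N) = e := by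
  induction d using Nat.strong_induction_on generalizing N with
  | h d ih =>
    by_cases hHom : Nontrivial (M →ₗ[R] N)
    · refine ⟨0, d, zero_add d, ⟨by simp, ?_⟩,
        supportDim_tensorProduct_of_nontrivial_linearMap hdepth hdim hHom⟩
      rwa [← not_subsingleton_iff_nontrivial, subsingleton_ext_zero_iff,
        not_subsingleton_iff_nontrivial]
    -- Otherwise divide by an `N`-regular element `x` that annihilates `M`: this lowers the grade
    -- and the dimension of `N` by one, and does not change the support of `M ⊗ N`.
    · obtain ⟨x, hxM, reg⟩ :=
        IsSMulRegular.subsingleton_linearMap_iff.mp (not_nontrivial_iff_subsingleton.mp hHom)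
      have hxm : x ∈ maximalIdeal R := le_maximalIdeal
        (by rw [Ne, Module.annihilator_eq_top_iff]; exact not_subsingleton M) hxM
      have hxk : x ∈ Module.annihilator R (R ⧸ maximalIdeal R) := by
        rwa [Ideal.annihilator_quotient]
      obtain _ | d := d
      · exact absurd (subsingleton_ext_zero_iff.mpr
          (reg.linearMap_subsingleton_of_mem_annihilator hxk))
          (not_subsingleton_iff_nontrivial.mpr hdepth.2)
      have hntr : Nontrivial (QuotSMulTop x N) := nontrivial_quotSMulTop_of_mem_maximalIdeal N hxm
      have hdim' : Module.supportDim R (QuotSMulTop x N) = d := by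
        obtain ⟨n, hn⟩ := supportDim_eq_natCast R (QuotSMulTop x N)
        have := Module.supportDim_quotSMulTop_succ_eq_supportDim reg hxm
        rw [hdim, hn] at this
        rw [hn]
        norm_cast at this ⊢
        omega
      obtain ⟨g, e, hge, hg, he⟩ := ih d (by omega)
        ((isFirstExt_quotSMulTop_iff hxk reg).mpr hdepth) hdim'
      refine ⟨g + 1, e, by omega, (isFirstExt_quotSMulTop_iff hxM reg).mp hg, ?_⟩
      rw [← he]
      have hsupp : Module.support R (M ⊗[R] N) = Module.support R (M ⊗[R] QuotSMulTop x N) := by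
        rw [support_tensorProduct, support_tensorProduct, Module.support_quotSMulTop,
          ← Set.inter_assoc, eq_comm, Set.inter_eq_left]
        rintro p ⟨hp, -⟩
        rw [Module.support_eq_zeroLocus] at hp
        exact Set.singleton_subset_iff.mpr (hp hxM)
      rw [Module.supportDim, hsupp, ← Module.supportDim]

end Grade

/-! ### Vanishing of `Tor` along a flat resolution -/

section TensorChase

variable {R : Type*} [CommRing R] {K F M A₀ A₁ A₂ : Type*}
  [AddCommGroup K] [Module R K] [AddCommGroup F] [Module R F] [AddCommGroup M] [Module R M]
  [AddCommGroup A₀] [Module R A₀] [AddCommGroup A₁] [Module R A₁] [AddCommGroup A₂] [Module R A₂]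

lemma lTensor_rTensor_comm {X Y P Q : Type*} [AddCommGroup X] [Module R X] [AddCommGroup Y]
    [Module R Y] [AddCommGroup P] [Module R P] [AddCommGroup Q] [Module R Q] (a : X →ₗ[R] Y)
    (b : P →ₗ[R] Q) (t : X ⊗[R] P) :
    b.lTensor Y (a.rTensor P t) = a.rTensor Q (b.lTensor X t) := by
  rw [← LinearMap.comp_apply, ← LinearMap.comp_apply, LinearMap.lTensor_comp_rTensor,
    LinearMap.rTensor_comp_lTensor]

/-- The diagram chase behind the long exact sequence of `Tor`: for `0 → K → F → M → 0` and a
complex `A₂ → A₁ → A₀` with `A₀` flat that stays exact after `M ⊗ -`, an element of `K ⊗ A₀` which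
is a boundary in `F ⊗ A₀` is a boundary in `K ⊗ A₀`. -/
lemma mem_range_lTensor_of_rTensor_mem_range {f : K →ₗ[R] F} {g : F →ₗ[R] M}
    (hf : Function.Injective f) (hfg : Function.Exact f g) (hg : Function.Surjective g)
    {d₂ : A₂ →ₗ[R] A₁} {d₁ : A₁ →ₗ[R] A₀} [Module.Flat R A₀] (hd : d₁ ∘ₗ d₂ = 0)
    (hM : Function.Exact (d₂.lTensor M) (d₁.lTensor M)) {z : K ⊗[R] A₀} {w : F ⊗[R] A₁}
    (hzw : d₁.lTensor F w = f.rTensor A₀ z) : ∃ y, d₁.lTensor K y = z := by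
  have hw : d₁.lTensor M (g.rTensor A₁ w) = 0 := by
    rw [lTensor_rTensor_comm, hzw]
    exact (rTensor_exact A₀ hfg hg).apply_apply_eq_zero z
  obtain ⟨u, hu⟩ := (hM _).mp hw
  obtain ⟨u, rfl⟩ := g.rTensor_surjective A₂ hg u
  obtain ⟨y, hy⟩ := (rTensor_exact A₁ hfg hg (w - d₂.lTensor F u)).mp
    (by rw [map_sub, ← lTensor_rTensor_comm, hu, sub_self])
  refine ⟨y, Module.Flat.rTensor_preserves_injective_linearMap f hf ?_⟩
  have hdd : d₁.lTensor F (d₂.lTensor F u) = 0 := by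
    rw [← LinearMap.comp_apply, ← LinearMap.lTensor_comp, hd]
    simp
  rw [← lTensor_rTensor_comm, hy, map_sub, hzw, hdd, sub_zero]

end TensorChase

section TorResolution

variable {R : Type u} [CommRing R]

/-- The complex `M ⊗ P` is exact in positive degrees. For a projective resolution `P` of `N` this
says that `Tor_i (M, N) = 0` for all `i > 0`. -/
def TensorAcyclic (P : ChainComplex (ModuleCat.{u} R) ℕ) (M : Type u) [AddCommGroup M]
    [Module R M] : Prop :=
  ∀ i : ℕ, Function.Exact ((P.d (i + 2) (i + 1)).hom.lTensor M) ((P.d (i + 1) i).hom.lTensor M)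

lemma TorVanishes.tensorAcyclic {M N : Type u} [AddCommGroup M] [Module R M] [AddCommGroup N]
    [Module R N] (h : ∀ i : ℕ, 0 < i → TorVanishes R M N i)
    (P : ProjectiveResolution (ModuleCat.of R N)) : TensorAcyclic P.complex M := by
  intro i
  let F := (MonoidalCategory.tensoringLeft (ModuleCat.{u} R)).obj (ModuleCat.of R M)
  have h₁ := (h (i + 1) i.succ_pos).of_iso (P.isoLeftDerivedObj F (i + 1)).symm
  have h₂ := (HomologicalComplex.exactAt_iff_isZero_homology _ _).mpr h₁
  rw [HomologicalComplex.exactAt_iff' _ (i + 2) (i + 1) i (by simp) (by simp),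
    ShortComplex.ShortExact.moduleCat_exact_iff_function_exact] at h₂
  exact h₂

lemma CategoryTheory.ProjectiveResolution.function_exact_d {N : ModuleCat.{u} R}
    (P : ProjectiveResolution N) (i : ℕ) :
    Function.Exact (P.complex.d (i + 2) (i + 1)).hom (P.complex.d (i + 1) i).hom := by
  have h := P.exact_succ i
  rwa [ShortComplex.ShortExact.moduleCat_exact_iff_function_exact] at h

lemma CategoryTheory.ProjectiveResolution.exists_augmentation {N : ModuleCat.{u} R}
    (P : ProjectiveResolution N) : ∃ ε : P.complex.X 0 →ₗ[R] N,
      Function.Exact (P.complex.d 1 0).hom ε ∧ Function.Surjective ε := by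
  have h := P.exact₀
  rw [ShortComplex.ShortExact.moduleCat_exact_iff_function_exact] at h
  exact ⟨(P.π.f 0).hom, h, (ModuleCat.epi_iff_surjective _).mp inferInstance⟩

instance CategoryTheory.ProjectiveResolution.flat_complex_X {N : ModuleCat.{u} R}
    (P : ProjectiveResolution N) (i : ℕ) : Module.Flat R (P.complex.X i) :=
  have : Module.Projective R (P.complex.X i) :=
    (IsProjective.iff_projective _).mpr (P.projective i)
  inferInstance

lemma CategoryTheory.ProjectiveResolution.hom_d_comp_d {N : ModuleCat.{u} R}
    (P : ProjectiveResolution N) (i : ℕ) :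
    (P.complex.d (i + 1) i).hom ∘ₗ (P.complex.d (i + 2) (i + 1)).hom = 0 := by
  rw [← ModuleCat.hom_comp, P.complex.d_comp_d, ModuleCat.hom_zero]

variable {K F M : Type u} [AddCommGroup K] [Module R K] [AddCommGroup F] [Module R F]
  [AddCommGroup M] [Module R M] {f : K →ₗ[R] F} {g : F →ₗ[R] M}
  (hf : Function.Injective f) (hfg : Function.Exact f g) (hg : Function.Surjective g)
  {N : ModuleCat.{u} R} (P : ProjectiveResolution N)
include hf hfg hg

lemma TensorAcyclic.of_exact [Module.Flat R F] (hM : TensorAcyclic P.complex M) :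
    TensorAcyclic P.complex K := by
  refine fun i z ↦ ⟨fun hz ↦ ?_, ?_⟩
  · have hz' : (P.complex.d (i + 1) i).hom.lTensor F (f.rTensor _ z) = 0 := by
      rw [lTensor_rTensor_comm, hz, map_zero]
    obtain ⟨w, hw⟩ := (Module.Flat.lTensor_exact F (P.function_exact_d i) _).mp hz'
    exact mem_range_lTensor_of_rTensor_mem_range hf hfg hg (P.hom_d_comp_d (i + 1))
      (hM (i + 1)) hw
  · rintro ⟨w, rfl⟩
    rw [← LinearMap.comp_apply, ← LinearMap.lTensor_comp, P.hom_d_comp_d]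
    simp

lemma TensorAcyclic.rTensor_injective (hM : TensorAcyclic P.complex M) :
    Function.Injective (f.rTensor N) := by
  obtain ⟨ε, hε, hεs⟩ := P.exists_augmentation
  rw [injective_iff_map_eq_zero]
  intro z hz
  obtain ⟨z, rfl⟩ := ε.lTensor_surjective K hεs z
  rw [← lTensor_rTensor_comm] at hz
  obtain ⟨w, hw⟩ := (lTensor_exact F hε hεs _).mp hz
  obtain ⟨y, rfl⟩ := mem_range_lTensor_of_rTensor_mem_range hf hfg hg (P.hom_d_comp_d 0)
    (hM 0) hw
  exact (lTensor_exact K hε hεs).apply_apply_eq_zero y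

end TorResolution

/-! ### `Ext` with values in a tensor product with a free module -/

section FreeTensor

variable {R : Type u} [CommRing R] {X M N : Type u} [AddCommGroup X] [Module R X]
  [AddCommGroup M] [Module R M] [AddCommGroup N] [Module R N]

lemma ext_comp_mk₀_ofHom_sum {n : ℕ} (e : Ext.{u} (ModuleCat.of R X) (ModuleCat.of R N) n)
    {ι : Type*} [Fintype ι] (φ : ι → N →ₗ[R] M) :
    e.comp (Ext.mk₀ (ModuleCat.ofHom (∑ i, φ i))) (add_zero n) =
      ∑ i, e.comp (Ext.mk₀ (ModuleCat.ofHom (φ i))) (add_zero n) := by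
  have h : ModuleCat.ofHom (∑ i, φ i) = ∑ i, ModuleCat.ofHom (φ i) := by
    ext y
    simp
  rw [h, Ext.mk₀_sum, Ext.comp_sum]

/-- A map is zero on `Ext (X, -)` if it is a linear combination of maps with coefficients in the
annihilator of `X`. -/
lemma ext_comp_mk₀_ofHom_sum_smul {n : ℕ} (e : Ext.{u} (ModuleCat.of R X) (ModuleCat.of R N) n)
    {ι : Type*} [Fintype ι] {a : ι → R} (ha : ∀ i, a i ∈ Module.annihilator R X)
    (φ : ι → N →ₗ[R] M) :
    e.comp (Ext.mk₀ (ModuleCat.ofHom (∑ i, a i • φ i))) (add_zero n) = 0 := by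
  rw [ext_comp_mk₀_ofHom_sum]
  refine Finset.sum_eq_zero fun i _ ↦ ?_
  have h : ModuleCat.ofHom (a i • φ i) = a i • ModuleCat.ofHom (φ i) := rfl
  rw [h, Ext.mk₀_smul, Ext.comp_smul]
  exact ext_smul_eq_zero_of_mem_annihilator (ha i) _

lemma ext_comp_mk₀_injective_of_leftInverse {n : ℕ} {f : N →ₗ[R] M} {g : M →ₗ[R] N}
    (hgf : g ∘ₗ f = LinearMap.id) {e : Ext.{u} (ModuleCat.of R X) (ModuleCat.of R N) n}
    (h : e.comp (Ext.mk₀ (ModuleCat.ofHom f)) (add_zero n) = 0) : e = 0 := by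
  have h' := congrArg (fun t ↦ t.comp (Ext.mk₀ (ModuleCat.ofHom g)) (add_zero n)) h
  simpa only [Ext.comp_assoc_of_third_deg_zero, Ext.mk₀_comp_mk₀, ← ModuleCat.ofHom_comp, hgf,
    ModuleCat.ofHom_id, Ext.comp_mk₀_id, Ext.zero_comp] using h'

lemma subsingleton_ext_tensorProduct_of_free [Module.Free R M] [Module.Finite R M] {n : ℕ}
    (h : Subsingleton (Ext.{u} (ModuleCat.of R X) (ModuleCat.of R N) n)) :
    Subsingleton (Ext.{u} (ModuleCat.of R X) (ModuleCat.of R (M ⊗[R] N)) n) := by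
  refine subsingleton_of_forall_eq 0 fun e ↦ ?_
  let b := Module.Free.chooseBasis R M
  let π (i) : M ⊗[R] N →ₗ[R] N := TensorProduct.lid R N ∘ₗ (b.coord i).rTensor N
  have hid : ∑ i, TensorProduct.mk R M N (b i) ∘ₗ π i = LinearMap.id := by
    refine TensorProduct.ext' fun m y ↦ ?_
    simp only [LinearMap.coe_sum, Finset.sum_apply, LinearMap.comp_apply, π,
      LinearMap.rTensor_tmul, LinearEquiv.coe_coe, TensorProduct.lid_tmul, map_smul,
      TensorProduct.mk_apply, LinearMap.id_apply, TensorProduct.smul_tmul', ← TensorProduct.sum_tmul]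
    rw [show ∑ i, b.coord i m • b i = m from b.sum_repr m]
  have he : e.comp (Ext.mk₀ (ModuleCat.ofHom LinearMap.id)) (add_zero n) = e := by
    rw [ModuleCat.ofHom_id, Ext.comp_mk₀_id]
  rw [← he, ← hid, ext_comp_mk₀_ofHom_sum]
  refine Finset.sum_eq_zero fun i _ ↦ ?_
  rw [ModuleCat.ofHom_comp, ← Ext.mk₀_comp_mk₀, ← Ext.comp_assoc_of_third_deg_zero,
    h.elim (e.comp _ _) 0, Ext.zero_comp]

lemma IsFirstExt.tensorProduct_of_free [Module.Free R M] [Module.Finite R M] [Nontrivial R]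
    [Nontrivial M] {d : ℕ} (h : IsFirstExt R X N d) : IsFirstExt R X (M ⊗[R] N) d := by
  refine ⟨fun i hi ↦ subsingleton_ext_tensorProduct_of_free (h.1 i hi), ?_⟩
  let b := Module.Free.chooseBasis R M
  obtain ⟨i⟩ := b.index_nonempty
  obtain ⟨e, he⟩ := @exists_ne _ h.2 (0 : Ext.{u} (ModuleCat.of R X) (ModuleCat.of R N) d)
  refine ⟨e.comp (Ext.mk₀ (ModuleCat.ofHom (TensorProduct.mk R M N (b i)))) (add_zero d), 0,
    fun h0 ↦ he (ext_comp_mk₀_injective_of_leftInverse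
      (g := TensorProduct.lid R N ∘ₗ (b.coord i).rTensor N) ?_ h0)⟩
  ext y
  simp

end FreeTensor

section Minimal

variable {R : Type u} [CommRing R] [IsLocalRing R] {K F M N : Type u} [AddCommGroup K] [Module R K]
  [AddCommGroup F] [Module R F] [AddCommGroup M] [Module R M] [AddCommGroup N] [Module R N]
  [Module.Free R K] [Module.Finite R K] [Module.Free R F] [Module.Finite R F]
  {f : K →ₗ[R] F} {g : F →ₗ[R] M} (hfg : Function.Exact f g) (hg : Function.Surjective g)
  (hM : ¬ Module.Free R M)
include hfg hg hM

/-- If a presentation `K → F → M → 0` by free modules presents a module which is not free, then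
`K → F` sends some basis element of `K` into `mF`. -/
lemma exists_unimodular_map_mem_maximalIdeal :
    ∃ (v : K) (φ : K →ₗ[R] R), φ v = 1 ∧ ∀ ψ : F →ₗ[R] R, ψ (f v) ∈ maximalIdeal R := by
  have hninj : ¬ Function.Injective (f.lTensor (ResidueField R)) := fun h ↦
    hM (Module.free_of_lTensor_residueField_injective f g hg hfg h)
  rw [injective_iff_map_eq_zero] at hninj
  push Not at hninj
  obtain ⟨w, hw, hw0⟩ := hninj
  obtain ⟨v, rfl⟩ := TensorProduct.mk_surjective R K (ResidueField R) residue_surjective w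
  have key {L : Type u} [AddCommGroup L] [Module R L] (ψ : L →ₗ[R] R) (l : L)
      (hl : (1 : ResidueField R) ⊗ₜ[R] l = 0) : ψ l ∈ maximalIdeal R := by
    have h := congrArg (fun t ↦ TensorProduct.rid R (ResidueField R) (ψ.lTensor _ t)) hl
    rw [← residue_eq_zero_iff]
    simpa [Algebra.smul_def] using h
  let b := Module.Free.chooseBasis R K
  obtain ⟨i, hi⟩ : ∃ i, b.repr v i ∉ maximalIdeal R := by
    by_contra! h
    refine hw0 ?_
    rw [← b.sum_repr v, map_sum]
    refine Finset.sum_eq_zero fun i _ ↦ ?_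
    rw [TensorProduct.mk_apply, TensorProduct.tmul_smul, TensorProduct.smul_tmul',
      Algebra.smul_def, ResidueField.algebraMap_eq, (residue_eq_zero_iff _).mpr (h i)]
    simp
  obtain ⟨u, hu⟩ := (IsLocalRing.notMem_maximalIdeal.mp hi)
  refine ⟨v, (↑u⁻¹ : R) • b.coord i, ?_, fun ψ ↦ key ψ _ (by simpa using hw)⟩
  rw [LinearMap.smul_apply, Module.Basis.coord_apply, ← hu, smul_eq_mul, Units.inv_mul]

/-- The map `K ⊗ N → F ⊗ N` is not injective on the first nonvanishing `Ext (k, -)`. -/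
lemma exists_ext_comp_rTensor_eq_zero {n : ℕ}
    (h : Nontrivial (Ext.{u} (ModuleCat.of R (R ⧸ maximalIdeal R)) (ModuleCat.of R N) n)) :
    ∃ e : Ext.{u} (ModuleCat.of R (R ⧸ maximalIdeal R)) (ModuleCat.of R (K ⊗[R] N)) n,
      e ≠ 0 ∧ e.comp (Ext.mk₀ (ModuleCat.ofHom (f.rTensor N))) (add_zero n) = 0 := by
  obtain ⟨v, φ, hφ, hv⟩ := exists_unimodular_map_mem_maximalIdeal hfg hg hM
  obtain ⟨e, he⟩ := exists_ne
    (0 : Ext.{u} (ModuleCat.of R (R ⧸ maximalIdeal R)) (ModuleCat.of R N) n)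
  refine ⟨e.comp (Ext.mk₀ (ModuleCat.ofHom (TensorProduct.mk R K N v))) (add_zero n),
    fun h0 ↦ he (ext_comp_mk₀_injective_of_leftInverse
      (g := TensorProduct.lid R N ∘ₗ φ.rTensor N) ?_ h0), ?_⟩
  · ext y
    simp [hφ]
  · let b := Module.Free.chooseBasis R F
    have hsum : f.rTensor N ∘ₗ TensorProduct.mk R K N v =
        ∑ i, b.coord i (f v) • TensorProduct.mk R F N (b i) := by
      ext y
      simp only [LinearMap.comp_apply, TensorProduct.mk_apply, LinearMap.rTensor_tmul,
        LinearMap.coe_sum, Finset.sum_apply, LinearMap.smul_apply, TensorProduct.smul_tmul',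
        ← TensorProduct.sum_tmul]
      rw [show ∑ i, b.coord i (f v) • b i = f v from b.sum_repr (f v)]
    rw [Ext.comp_assoc_of_third_deg_zero, Ext.mk₀_comp_mk₀, ← ModuleCat.ofHom_comp, hsum]
    exact ext_comp_mk₀_ofHom_sum_smul e
      (fun i ↦ by rw [Ideal.annihilator_quotient]; exact hv _) _

end Minimal

/-! ### The depth formula -/

section DepthFormula

variable {R : Type u} [CommRing R]

/-- The depth lemma for `0 → A → B → C → 0` in the case where `Ext (X, A) → Ext (X, B)` has a
kernel in the first degree `n` in which `Ext (X, A)` does not vanish: the first nonvanishing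
`Ext (X, C)` is then one degree lower. -/
lemma IsFirstExt.of_exact_of_not_injective {X A B C : Type u} [AddCommGroup X] [Module R X]
    [AddCommGroup A] [Module R A] [AddCommGroup B] [Module R B] [AddCommGroup C] [Module R C]
    {f : A →ₗ[R] B} {g : B →ₗ[R] C} (hf : Function.Injective f) (hfg : Function.Exact f g)
    (hg : Function.Surjective g) {n : ℕ} (hA : IsFirstExt R X A n)
    (hB : ∀ i < n, Subsingleton (Ext.{u} (ModuleCat.of R X) (ModuleCat.of R B) i))
    {e : Ext.{u} (ModuleCat.of R X) (ModuleCat.of R A) n} (he : e ≠ 0)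
    (hef : e.comp (Ext.mk₀ (ModuleCat.ofHom f)) (add_zero n) = 0) :
    ∃ m, m + 1 = n ∧ IsFirstExt R X C m := by
  let S := ShortComplex.mk (ModuleCat.ofHom f) (ModuleCat.ofHom g)
    (by rw [← ModuleCat.ofHom_comp, hfg.linearMap_comp_eq_zero]; rfl)
  have hS : S.ShortExact :=
    { exact := (ShortComplex.ShortExact.moduleCat_exact_iff_function_exact S).mpr hfg
      mono_f := (ModuleCat.mono_iff_injective _).mpr hf
      epi_g := (ModuleCat.epi_iff_surjective _).mpr hg }
  obtain _ | m := n
  · obtain ⟨φ, rfl⟩ := (Ext.mk₀_bijective _ _).2 e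
    rw [Ext.mk₀_comp_mk₀, Ext.mk₀_eq_zero_iff] at hef
    have : Mono (ModuleCat.ofHom f) := hS.mono_f
    exact absurd (by rw [Limits.zero_of_comp_mono _ hef, Ext.mk₀_zero]) he
  · refine ⟨m, rfl, fun i hi ↦ subsingleton_of_forall_eq 0 fun x ↦ ?_, ?_⟩
    · obtain ⟨y, hy⟩ := Ext.covariant_sequence_exact₃ (ModuleCat.of R X) hS x rfl
        ((hA.1 (i + 1) (by omega)).elim _ _)
      obtain rfl : y = 0 := (hB i (by omega)).elim _ _
      exact hy.symm.trans (Ext.zero_comp ..)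
    · obtain ⟨y, hy⟩ := Ext.covariant_sequence_exact₁ (ModuleCat.of R X) hS e hef rfl
      refine ⟨y, 0, ?_⟩
      rintro rfl
      exact he (hy.symm.trans (Ext.zero_comp ..))

variable [IsLocalRing R] [IsNoetherianRing R]

/-- Auslander's depth formula `depth (M ⊗ N) + pd M = depth N`, for `M` of finite projective
dimension and `Tor_i (M, N) = 0` for all `i > 0`. -/
lemma exists_isFirstExt_tensorProduct_add_projectiveDimension {N : Type u} [AddCommGroup N]
    [Module R N] (P : ProjectiveResolution (ModuleCat.of R N)) {d : ℕ}
    (hN : IsFirstExt R (R ⧸ maximalIdeal R) N d) (p : ℕ) (M : Type u) [AddCommGroup M] [Module R M]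
    [Module.Finite R M] (hlt : HasProjectiveDimensionLT (ModuleCat.of R M) (p + 1))
    (hge : ¬ HasProjectiveDimensionLT (ModuleCat.of R M) p)
    (hM : TensorAcyclic P.complex M) :
    ∃ e, e + p = d ∧ IsFirstExt R (R ⧸ maximalIdeal R) (M ⊗[R] N) e := by
  have free_of_lt_one (L : Type u) [AddCommGroup L] [Module R L] [Module.Finite R L]
      (h : HasProjectiveDimensionLT (ModuleCat.of R L) 1) : Module.Free R L := by
    have : Module.Projective R L := (IsProjective.iff_projective L).mpr
      (projective_iff_hasProjectiveDimensionLT_one.mpr h)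
    exact Module.free_of_flat_of_isLocalRing
  induction p generalizing M with
  | zero =>
    have := free_of_lt_one M hlt
    rw [hasProjectiveDimensionLT_zero_iff_isZero, ModuleCat.isZero_iff_subsingleton,
      not_subsingleton_iff_nontrivial] at hge
    have : Nontrivial M := hge
    exact ⟨d, add_zero d, hN.tensorProduct_of_free⟩
  | succ p ih =>
    obtain ⟨n, g, hg⟩ := Module.Finite.exists_fin' R M
    have hS := LinearMap.shortExact_shortComplexKer hg
    have hF : Projective (ModuleCat.of R (Fin n → R)) :=
      (IsProjective.iff_projective _).mp inferInstance
    have hKlt : HasProjectiveDimensionLT (ModuleCat.of R (LinearMap.ker g)) (p + 1) :=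
      (hS.hasProjectiveDimensionLT_X₃_iff p hF).mp hlt
    have hKge : ¬ HasProjectiveDimensionLT (ModuleCat.of R (LinearMap.ker g)) p := fun h ↦
      have : HasProjectiveDimensionLT (ModuleCat.of R (Fin n → R)) (p + 1) :=
        hasProjectiveDimensionLT_of_ge _ 1 (p + 1) (by omega)
      hge (hS.hasProjectiveDimensionLT_X₃ p h this)
    have hinj := (LinearMap.ker g).injective_subtype
    have hexact := g.exact_subtype_ker_map
    obtain ⟨e, hed, he⟩ := ih (LinearMap.ker g) hKlt hKge (hM.of_exact hinj hexact hg)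
    obtain ⟨y, hy, hy0⟩ : ∃ y : Ext.{u} (ModuleCat.of R (R ⧸ maximalIdeal R))
        (ModuleCat.of R (LinearMap.ker g ⊗[R] N)) e, y ≠ 0 ∧
        y.comp (Ext.mk₀ (ModuleCat.ofHom ((LinearMap.ker g).subtype.rTensor N)))
          (add_zero e) = 0 := by
      obtain _ | p := p
      · have := free_of_lt_one _ hKlt
        refine exists_ext_comp_rTensor_eq_zero hexact hg (fun hfree ↦ hge ?_)
          (by rw [← hed] at hN; exact hN.2)
        exact projective_iff_hasProjectiveDimensionLT_one.mp
          ((IsProjective.iff_projective M).mp inferInstance)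
      · obtain ⟨y, hy⟩ := @exists_ne _ he.2 0
        exact ⟨y, hy, (subsingleton_ext_tensorProduct_of_free (hN.1 e (by omega))).elim _ _⟩
    obtain ⟨m, rfl, hm⟩ := he.of_exact_of_not_injective (hM.rTensor_injective hinj hexact hg)
      (rTensor_exact N hexact hg) (g.rTensor_surjective N hg)
      (fun i hi ↦ subsingleton_ext_tensorProduct_of_free (hN.1 i (by omega))) hy hy0
    exact ⟨m, by omega, hm⟩

end DepthFormula

lemma exists_projDim_eq_natCast {R : Type u} [CommRing R] {M : Type u} [AddCommGroup M]
    [Module R M] [Nontrivial M] (h : projDim R M < ⊤) :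
    ∃ p : ℕ, projDim R M = p ∧ HasProjectiveDimensionLT (ModuleCat.of R M) (p + 1) ∧
      ¬ HasProjectiveDimensionLT (ModuleCat.of R M) p := by
  have hbot : projDim R M ≠ ⊥ := by
    rw [projDim, Ne, projectiveDimension_eq_bot_iff, ModuleCat.isZero_iff_subsingleton]
    exact not_subsingleton M
  obtain ⟨a, ha⟩ := WithBot.ne_bot_iff_exists.mp hbot
  rw [← ha] at h
  obtain ⟨p, rfl⟩ := ENat.ne_top_iff_exists.mp (WithBot.coe_lt_coe.mp h).ne
  have hp : projDim R M = p := ha.symm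
  exact ⟨p, hp, (projectiveDimension_le_iff _ _).mp hp.le,
    (projectiveDimension_ge_iff _ _).mp hp.ge⟩

theorem theorem1p8 (R : Type u) [CommRing R] [IsLocalRing R] [IsNoetherianRing R]
    (M N : Type u) [AddCommGroup M] [Module R M] [AddCommGroup N] [Module R N]
    [Module.Finite R M] [Module.Finite R N] [Nontrivial M] [Nontrivial N]
    (hN : IsCohenMacaulayModule R N) (hM : projDim R M < ⊤)
    (hTor : ∀ i : ℕ, 0 < i → TorVanishes R M N i) :
    IsCohenMacaulayModule R (M ⊗[R] N) ↔ IsPerfectRel R M N := by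
  obtain ⟨d, hd⟩ := supportDim_eq_natCast R N
  have hdepth : IsFirstExt R (R ⧸ maximalIdeal R) N d := by
    rw [← moduleDepth_eq_iff]
    exact WithBot.coe_injective (hN.trans hd)
  obtain ⟨p, hp, hlt, hge⟩ := exists_projDim_eq_natCast hM
  let P := projectiveResolution (ModuleCat.of R N)
  obtain ⟨e, hed, he⟩ := exists_isFirstExt_tensorProduct_add_projectiveDimension P hdepth p M
    hlt hge (TorVanishes.tensorAcyclic hTor P)
  obtain ⟨g, e', hge', hg, he'⟩ :=
    exists_isFirstExt_add_supportDim_tensorProduct (M := M) hdepth hd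
  have : Nontrivial (M ⊗[R] N) := nontrivial_tensorProduct
  rw [IsCohenMacaulayModule, (moduleDepth_eq_iff e).mpr he, he', IsPerfectRel,
    and_iff_right hM, hp, hg.moduleGrade_eq]
  have hcast (a b : ℕ) : (((a : ℕ∞) : WithBot ℕ∞) = (b : WithBot ℕ∞)) ↔ a = b := by
    norm_cast
  have hcast' (a b : ℕ) : ((a : WithBot ℕ∞) = ((b : ℕ∞) : WithBot ℕ∞)) ↔ a = b := by
    norm_cast
  rw [hcast, hcast']
  omega
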